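/- For $x\in\mathbb R^n$ and $r>0$ let $B(x,r)$ be the closed ball. For a closed set $\Sigma\subset\mathbb R^n$, $x\in\Sigma$ and $r>0$, the local flatness of $\Sigma$ near $x$ at scale $r$ is $$\theta_\Sigma(x,r)=\frac1r\min_{L}\,\mathrm{HD}\big[\Sigma\cap B(x,r),\,(x+L)\cap B(x,r)\big],$$ where $L$ ranges over the $(n-1)$-dimensional linear subspaces of $\mathbb R^n$ and $\mathrm{HD}$ is the Hausdorff distance between nonempty compact sets. For $h:\mathbb R^n\to\mathbb R$ write $\Sigma_h=\{x\in\mathbb R^n: h(x)=0\}$ and let $Dh$ be the total derivative of $h$. Theorem. For all $n\ge 2$ and $d\ge 1$ there exists a constant $\delta_{n,d}>0$ such that for every harmonic polynomial $h:\mathbb R^n\to\mathbb R$ of degree $d$ and every $x\in\Sigma_h$, $$Dh(x)=0\iff \theta_{\Sigma_h}(x,r)\ge\delta_{n,d}\ \text{ for all } r>0,$$ $$Dh(x)\ne 0\iff \theta_{\Sigma_h}(x,r)<\delta_{n,d}\ \text{ for some } r>0.$$ Moreover, there exists a constant $C_{n,d}>1$, depending only on $n$ and $d$, such that for every harmonic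 polynomial $h:\mathbb R^n\to\mathbb R$ of degree $d$, every $x\in\Sigma_h$ and every $r>0$, if $\theta_{\Sigma_h}(x,r)<\delta_{n,d}$, then $\theta_{\Sigma_h}(x,sr)<C_{n,d}\,s$ for all $s\in(0,1)$. -/

import Mathlib

open Set Metric

noncomputable section

/-- The local flatness of `A ⊆ ℝⁿ` near `x` at scale `r`: the infimum over all linear hyperplanes
`L` (subspaces of dimension `n - 1`) of the Hausdorff distance between `A ∩ B(x, r)` and
`(x + L) ∩ B(x, r)`, divided by `r`. Balls are closed. For `x ∈ A` and `r > 0` both sets contain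
`x` and are bounded, so that the Hausdorff distance has its usual meaning. -/
def localFlatness {n : ℕ} (A : Set (EuclideanSpace ℝ (Fin n))) (x : EuclideanSpace ℝ (Fin n))
    (r : ℝ) : ℝ :=
  (1 / r) * ⨅ L : {L : Submodule ℝ (EuclideanSpace ℝ (Fin n)) // Module.finrank ℝ L + 1 = n},
    hausdorffDist (A ∩ closedBall x r)
      (((fun v => x + v) '' (L.1 : Set (EuclideanSpace ℝ (Fin n)))) ∩ closedBall x r)

/-- The real function on `ℝⁿ` given by a polynomial in `n` variables. -/
def polyFun {n : ℕ} (p : MvPolynomial (Fin n) ℝ) (x : EuclideanSpace ℝ (Fin n)) : ℝ :=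
  MvPolynomial.eval (fun i => x i) p

/-- The zero set of a real function on `ℝⁿ`. -/
def zeroSet {n : ℕ} (f : EuclideanSpace ℝ (Fin n) → ℝ) : Set (EuclideanSpace ℝ (Fin n)) :=
  {x | f x = 0}

/-- `f : ℝⁿ → ℝ` is a harmonic polynomial of degree `d`: it is a harmonic function on `ℝⁿ` that is
given by a polynomial of (total) degree `d`. -/
def IsHarmonicPolynomial {n : ℕ} (d : ℕ) (f : EuclideanSpace ℝ (Fin n) → ℝ) : Prop :=
  (∃ p : MvPolynomial (Fin n) ℝ, p.totalDegree = d ∧ f = polyFun p) ∧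
    InnerProductSpace.HarmonicOnNhd f univ

end

/-! The substitution `y ↦ p (x + r y)` turns every base point and scale into the unit ball at the
origin and stays in the finite-dimensional space of polynomials of degree at most `d`. There the
theorem becomes a gap statement (`exists_flatness_gap`): if the zeros in the unit ball lie in a thin
enough slab around a hyperplane `eᗮ`, the gradient at `0` is bounded below by a fixed multiple of
the coefficient norm.

The gap follows by compactness. A sequence of counterexamples, normalised, has a nonzero harmonic
limit `P` with `P 0 = 0` and zero gradient at `0`; `P` cannot change sign inside either open half
ball, since the approximants would then have zeros far from the hyperplane. If the two signs agree,
`P` or `-P` is nonnegative near `0`; if they differ, `l * P` is, for a linear form `l = ⟨·, ±e⟩`.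
The same then holds for the lowest homogeneous part `q` of `P`, which is harmonic of degree at least
2. But `q` is orthogonal to constants and to linear forms, so `q` or `l * q` is a nonnegative
polynomial of mean zero, hence zero: a contradiction. Orthogonality is taken for the Gaussian
measure, where it reduces to integration by parts (`gaussianMean_X_mul`).

Conversely, a gradient that dominates the quadratic Taylor remainder makes the zero set flat to
order `s` at scale `s * r` (`localFlatness_zeroSet_le`). At a regular point this gives flatness
below `δ` at some small scale; combined with the gap it gives the uniform constant `C`. -/

open MvPolynomial MeasureTheory
open scoped Topology

/-! ### Gaussian means of harmonic polynomials -/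

/-- The Laplacian on polynomials. -/
noncomputable def polyLaplacian (n : ℕ) : MvPolynomial (Fin n) ℝ →ₗ[ℝ] MvPolynomial (Fin n) ℝ :=
  ∑ i, (pderiv i).toLinearMap ∘ₗ (pderiv i).toLinearMap

theorem polyLaplacian_apply {n : ℕ} (p : MvPolynomial (Fin n) ℝ) :
    polyLaplacian n p = ∑ i, pderiv i (pderiv i p) := by
  simp [polyLaplacian]

theorem pderiv_pderiv_comm {n : ℕ} (i j : Fin n) (p : MvPolynomial (Fin n) ℝ) :
    pderiv i (pderiv j p) = pderiv j (pderiv i p) := by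
  have h : ⁅pderiv (R := ℝ) i, pderiv (R := ℝ) j⁆ = 0 := by
    apply MvPolynomial.derivation_ext
    intro k
    classical
    simp only [Derivation.commutator_apply, pderiv_X, Pi.single_apply]
    split_ifs <;> simp
  have := congrArg (fun D => D p) h
  simpa [Derivation.commutator_apply, sub_eq_zero] using this

theorem polyLaplacian_pderiv {n : ℕ} (i : Fin n) (p : MvPolynomial (Fin n) ℝ) :
    polyLaplacian n (pderiv i p) = pderiv i (polyLaplacian n p) := by
  simp only [polyLaplacian_apply, map_sum]
  refine Finset.sum_congr rfl fun j _ => ?_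
  rw [pderiv_pderiv_comm j i p, pderiv_pderiv_comm j i]

theorem integrable_pow_mul_gaussian (k : ℕ) :
    Integrable fun t : ℝ => t ^ k * Real.exp (-(1 / 2) * t ^ 2) := by
  have := integrable_rpow_mul_exp_neg_mul_sq (b := 1 / 2) (by norm_num) (s := k)
    (by have : (0 : ℝ) ≤ k := k.cast_nonneg
        linarith)
  simpa using this

/-- The derivative of `t ^ k * exp (-t² / 2)` integrates to zero. At `k = 0` the truncated exponent
`k - 1` is harmless because of the factor `k`. -/
theorem integral_pow_succ_mul_gaussian (k : ℕ) :
    ∫ t : ℝ, t ^ (k + 1) * Real.exp (-(1 / 2) * t ^ 2) =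
      k * ∫ t : ℝ, t ^ (k - 1) * Real.exp (-(1 / 2) * t ^ 2) := by
  have hd : ∀ t : ℝ, HasDerivAt (fun t : ℝ => t ^ k * Real.exp (-(1 / 2) * t ^ 2))
      (k * (t ^ (k - 1) * Real.exp (-(1 / 2) * t ^ 2)) -
        t ^ (k + 1) * Real.exp (-(1 / 2) * t ^ 2)) t := by
    intro t
    have h1 := (hasDerivAt_pow k t).mul (((hasDerivAt_pow 2 t).const_mul (-(1 / 2) : ℝ)).exp)
    convert! h1 using 1
    push_cast
    ring
  have h := integral_eq_zero_of_hasDerivAt_of_integrable hd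
    (((integrable_pow_mul_gaussian _).const_mul _).sub (integrable_pow_mul_gaussian _))
    (integrable_pow_mul_gaussian k)
  rw [integral_sub ((integrable_pow_mul_gaussian _).const_mul _) (integrable_pow_mul_gaussian _),
    integral_const_mul] at h
  linarith

theorem integrable_eval_mul_gaussian {n : ℕ} (p : MvPolynomial (Fin n) ℝ) :
    Integrable fun x : Fin n → ℝ => eval x p * ∏ i, Real.exp (-(1 / 2) * x i ^ 2) := by
  induction p using MvPolynomial.induction_on' with
  | monomial u a =>
    have := (Integrable.fintype_prod (f := fun i (t : ℝ) => t ^ u i * Real.exp (-(1 / 2) * t ^ 2))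
      (μ := fun _ => volume) fun i => integrable_pow_mul_gaussian (u i)).const_mul a
    refine this.congr (Filter.Eventually.of_forall fun x => ?_)
    simp only [eval_monomial, Finset.prod_mul_distrib, Finsupp.prod_pow, mul_assoc]
  | add p q hp hq =>
    refine (hp.add hq).congr (Filter.Eventually.of_forall fun x => ?_)
    simp [add_mul]

/-- The (unnormalised) Gaussian mean of a polynomial. -/
noncomputable def gaussianMean (n : ℕ) : MvPolynomial (Fin n) ℝ →ₗ[ℝ] ℝ where
  toFun p := ∫ x : Fin n → ℝ, eval x p * ∏ i, Real.exp (-(1 / 2) * x i ^ 2)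
  map_add' p q := by
    rw [← integral_add (integrable_eval_mul_gaussian p) (integrable_eval_mul_gaussian q)]
    simp [add_mul]
  map_smul' a p := by
    rw [RingHom.id_apply, smul_eq_mul, ← integral_const_mul]
    simp [smul_eval, mul_assoc]

theorem gaussianMean_monomial {n : ℕ} (u : Fin n →₀ ℕ) (a : ℝ) :
    gaussianMean n (monomial u a) =
      a * ∏ i, ∫ t : ℝ, t ^ u i * Real.exp (-(1 / 2) * t ^ 2) := by
  rw [← integral_fintype_prod_volume_eq_prod
    (fun i (t : ℝ) => t ^ u i * Real.exp (-(1 / 2) * t ^ 2)), ← integral_const_mul]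
  refine integral_congr_ae (Filter.Eventually.of_forall fun x => ?_)
  simp only [eval_monomial, Finset.prod_mul_distrib, Finsupp.prod_pow, mul_assoc]

/-- Gaussian integration by parts. -/
theorem gaussianMean_X_mul {n : ℕ} (i : Fin n) (p : MvPolynomial (Fin n) ℝ) :
    gaussianMean n (X i * p) = gaussianMean n (pderiv i p) := by
  induction p using MvPolynomial.induction_on' with
  | monomial u a =>
    have hX : X i * monomial u a = monomial (Finsupp.single i 1 + u) a := by
      rw [X, monomial_mul, one_mul]
    rw [hX, pderiv_monomial, gaussianMean_monomial, gaussianMean_monomial,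
      ← Finset.mul_prod_erase _ _ (Finset.mem_univ i), ← Finset.mul_prod_erase
      (a := i) _ (fun j => ∫ t : ℝ, t ^ (u - Finsupp.single i 1 : Fin n →₀ ℕ) j * Real.exp (-(1 / 2) * t ^ 2))
        (Finset.mem_univ i)]
    have h1 : ∀ j ∈ Finset.univ.erase i,
        ∫ t : ℝ, t ^ (Finsupp.single i 1 + u : Fin n →₀ ℕ) j * Real.exp (-(1 / 2) * t ^ 2) =
        ∫ t : ℝ, t ^ (u - Finsupp.single i 1 : Fin n →₀ ℕ) j * Real.exp (-(1 / 2) * t ^ 2) := by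
      intro j hj
      have hji : i ≠ j := (Finset.ne_of_mem_erase hj).symm
      simp [hji]
    rw [Finset.prod_congr rfl h1]
    simp only [Finsupp.add_apply, Finsupp.single_eq_same, Finsupp.tsub_apply]
    rw [add_comm 1, integral_pow_succ_mul_gaussian]
    ring
  | add p q hp hq => simp only [mul_add, map_add, hp, hq]

/-- Euler's identity `m q = ∑ xᵢ ∂ᵢq` and integration by parts show that `m` times the mean of `q`
is the mean of its Laplacian. -/
theorem gaussianMean_eq_zero {n m : ℕ} {q : MvPolynomial (Fin n) ℝ} (hq : q.IsHomogeneous m)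
    (hm : m ≠ 0) (hL : polyLaplacian n q = 0) : gaussianMean n q = 0 := by
  have h := congrArg (gaussianMean n) hq.sum_X_mul_pderiv
  simp only [map_sum, gaussianMean_X_mul, map_nsmul] at h
  rw [← map_sum, ← polyLaplacian_apply, hL, map_zero] at h
  simpa [hm] using h.symm

/-- Orthogonality to linear forms: after integration by parts `∂ᵢq` is again harmonic and
homogeneous, of positive degree `m - 1`. -/
theorem gaussianMean_X_mul_eq_zero {n m : ℕ} {q : MvPolynomial (Fin n) ℝ}
    (hq : q.IsHomogeneous m) (hm : 2 ≤ m) (hL : polyLaplacian n q = 0) (i : Fin n) :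
    gaussianMean n (X i * q) = 0 := by
  rw [gaussianMean_X_mul]
  refine gaussianMean_eq_zero (m := m - 1) hq.pderiv (by omega) ?_
  rw [polyLaplacian_pderiv, hL, map_zero]

/-- A nonnegative polynomial with vanishing Gaussian mean is zero. -/
theorem eq_zero_of_gaussianMean_eq_zero {n : ℕ} {q : MvPolynomial (Fin n) ℝ}
    (h0 : ∀ x, 0 ≤ eval x q) (hE : gaussianMean n q = 0) : q = 0 := by
  have hc : Continuous fun x : Fin n → ℝ => eval x q * ∏ i, Real.exp (-(1 / 2) * x i ^ 2) := by
    have := q.continuous_eval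
    fun_prop
  have h := (integral_eq_zero_iff_of_nonneg (fun x => mul_nonneg (h0 x)
    (Finset.prod_nonneg fun i _ => (Real.exp_pos _).le)) (integrable_eval_mul_gaussian q)).1 hE
  have h2 := (hc.ae_eq_iff_eq volume continuous_const).1 h
  refine MvPolynomial.funext fun x => ?_
  have h3 : eval x q * ∏ i, Real.exp (-(1 / 2) * x i ^ 2) = 0 := congrFun h2 x
  have h4 : (∏ i, Real.exp (-(1 / 2) * x i ^ 2)) ≠ 0 :=
    Finset.prod_ne_zero_iff.2 fun i _ => (Real.exp_pos _).ne'
  simpa using (mul_eq_zero.1 h3).resolve_right h4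

/-! ### Lowest homogeneous parts and sign rigidity -/

theorem pderiv_homogeneousComponent {n : ℕ} (i : Fin n) (k : ℕ) (p : MvPolynomial (Fin n) ℝ) :
    pderiv i (homogeneousComponent (k + 1) p) = homogeneousComponent k (pderiv i p) := by
  ext u
  rw [coeff_pderiv, coeff_homogeneousComponent, coeff_homogeneousComponent, coeff_pderiv]
  simp

/-- The Laplacian lowers degree by exactly two, so it respects the grading; parts of degree 0 and 1
are killed outright. -/
theorem polyLaplacian_homogeneousComponent {n : ℕ} {p : MvPolynomial (Fin n) ℝ}
    (hp : polyLaplacian n p = 0) (k : ℕ) :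
    polyLaplacian n (homogeneousComponent k p) = 0 := by
  match k with
  | 0 => simp [polyLaplacian_apply, homogeneousComponent_zero]
  | 1 =>
    simp only [polyLaplacian_apply, pderiv_homogeneousComponent _ 0, homogeneousComponent_zero,
      pderiv_C, Finset.sum_const_zero]
  | k + 2 =>
    simp only [polyLaplacian_apply, pderiv_homogeneousComponent]
    rw [← map_sum, ← polyLaplacian_apply, hp, map_zero]

theorem eval_smul_eq_sum {n : ℕ} (p : MvPolynomial (Fin n) ℝ) (t : ℝ) (x : Fin n → ℝ) :
    eval (t • x) p =
      ∑ k ∈ Finset.range (p.totalDegree + 1), t ^ k * eval x (homogeneousComponent k p) := by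
  conv_lhs => rw [← sum_homogeneousComponent p]
  rw [map_sum]
  refine Finset.sum_congr rfl fun k _ => ?_
  rw [eval_eq', eval_eq', Finset.mul_sum]
  refine Finset.sum_congr rfl fun u hu => ?_
  have hdeg : ∑ i, u i = k := by
    have := homogeneousComponent_isHomogeneous k p (mem_support_iff.1 hu)
    simpa [Finsupp.weight_apply, Finsupp.sum_fintype] using this
  simp only [Pi.smul_apply, smul_eq_mul, mul_pow, Finset.prod_mul_distrib,
    Finset.prod_pow_eq_pow_sum, hdeg]
  ring

/-- The first nonvanishing homogeneous component of a polynomial that is nonnegative near the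
origin is nonnegative everywhere. -/
theorem eval_homogeneousComponent_nonneg {n m : ℕ} {p : MvPolynomial (Fin n) ℝ}
    (hm : ∀ k < m, homogeneousComponent k p = 0) {x : Fin n → ℝ} {ε : ℝ} (hε : 0 < ε)
    (h : ∀ t ∈ Ioo 0 ε, 0 ≤ eval (t • x) p) : 0 ≤ eval x (homogeneousComponent m p) := by
  by_cases hmd : p.totalDegree < m
  · simp [homogeneousComponent_eq_zero m p hmd]
  -- `F t` is `p (t x) / t ^ m` extended continuously to `t = 0`; the exponents truncated by `k - m`
  -- belong to components that vanish.
  set F : ℝ → ℝ := fun t => ∑ k ∈ Finset.range (p.totalDegree + 1),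
    t ^ (k - m) * eval x (homogeneousComponent k p) with hF
  have hFc : Continuous F := by fun_prop
  have hF0 : F 0 = eval x (homogeneousComponent m p) := by
    simp only [hF]
    rw [Finset.sum_eq_single m]
    · simp
    · intro k _ hkm
      rcases lt_or_gt_of_ne hkm with h1 | h1
      · simp [hm k h1]
      · rw [zero_pow (by omega), zero_mul]
    · intro h1
      exact absurd (Finset.mem_range.2 (by omega)) h1
  have hFe : ∀ t, t ^ m * F t = eval (t • x) p := by
    intro t
    rw [eval_smul_eq_sum, hF, Finset.mul_sum]
    refine Finset.sum_congr rfl fun k _ => ?_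
    rcases lt_or_ge k m with h1 | h1
    · simp [hm k h1]
    · rw [← mul_assoc, ← pow_add, Nat.add_sub_cancel' h1]
  rw [← hF0]
  have hlim : Filter.Tendsto F (nhdsWithin 0 (Ioi 0)) (nhds (F 0)) :=
    hFc.continuousAt.continuousWithinAt
  refine ge_of_tendsto hlim ?_
  filter_upwards [Ioo_mem_nhdsGT hε] with t ht
  have h1 := h t ht
  rw [← hFe] at h1
  exact nonneg_of_mul_nonneg_right h1 (pow_pos ht.1 m)

theorem exists_first_homogeneousComponent {n : ℕ} {p : MvPolynomial (Fin n) ℝ} (hp : p ≠ 0) :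
    ∃ m, homogeneousComponent m p ≠ 0 ∧ ∀ k < m, homogeneousComponent k p = 0 := by
  classical
  have hex : ∃ m, homogeneousComponent m p ≠ 0 := by
    by_contra! h
    apply hp
    rw [← sum_homogeneousComponent p]
    exact Finset.sum_eq_zero fun k _ => h k
  exact ⟨Nat.find hex, Nat.find_spec hex, fun k hk => not_not.1 (Nat.find_min hex hk)⟩

theorem homogeneousComponent_zero_eq_zero {n : ℕ} {p : MvPolynomial (Fin n) ℝ}
    (h0 : eval 0 p = 0) : homogeneousComponent 0 p = 0 := by
  rw [homogeneousComponent_zero, ← constantCoeff_eq, ← eval_zero, h0, C_0]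

theorem homogeneousComponent_one_eq_zero {n : ℕ} {p : MvPolynomial (Fin n) ℝ}
    (h1 : ∀ i, eval 0 (pderiv i p) = 0) : homogeneousComponent 1 p = 0 := by
  have h := (homogeneousComponent_isHomogeneous 1 p).sum_X_mul_pderiv
  simp only [pderiv_homogeneousComponent _ 0, homogeneousComponent_zero_eq_zero (h1 _),
    mul_zero, Finset.sum_const_zero] at h
  simpa using h.symm

/-- A harmonic polynomial vanishing at the origin and nonnegative near it is zero. -/
theorem harmonic_eq_zero_of_nonneg {n : ℕ} {p : MvPolynomial (Fin n) ℝ}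
    (hL : polyLaplacian n p = 0) (h0 : eval 0 p = 0)
    (h : ∀ x : Fin n → ℝ, ∃ ε : ℝ, 0 < ε ∧ ∀ t ∈ Ioo 0 ε, 0 ≤ eval (t • x) p) : p = 0 := by
  by_contra hp
  obtain ⟨m, hm, hk⟩ := exists_first_homogeneousComponent hp
  refine hm (eq_zero_of_gaussianMean_eq_zero (fun x => ?_)
    (gaussianMean_eq_zero (homogeneousComponent_isHomogeneous m p) ?_
      (polyLaplacian_homogeneousComponent hL m)))
  · obtain ⟨ε, hε, hx⟩ := h x
    exact eval_homogeneousComponent_nonneg hk hε hx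
  · rintro rfl
    exact hm (homogeneousComponent_zero_eq_zero h0)

/-- A harmonic polynomial vanishing to second order at the origin, whose product with a nonzero
linear form is nonnegative near the origin, is zero. -/
theorem harmonic_eq_zero_of_linear_mul_nonneg {n : ℕ} {p : MvPolynomial (Fin n) ℝ}
    (hL : polyLaplacian n p = 0) (h0 : eval 0 p = 0) (h1 : ∀ i, eval 0 (pderiv i p) = 0)
    {e : Fin n → ℝ} (he : e ≠ 0)
    (h : ∀ x : Fin n → ℝ, ∃ ε : ℝ, 0 < ε ∧ ∀ t ∈ Ioo 0 ε, 0 ≤ (∑ i, e i * x i) * eval (t • x) p) :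
    p = 0 := by
  by_contra hp
  obtain ⟨m, hm, hk⟩ := exists_first_homogeneousComponent hp
  have hm2 : 2 ≤ m := by
    by_contra hlt
    obtain rfl | rfl : m = 0 ∨ m = 1 := by omega
    · exact hm (homogeneousComponent_zero_eq_zero h0)
    · exact hm (homogeneousComponent_one_eq_zero h1)
  set l : MvPolynomial (Fin n) ℝ := ∑ i, C (e i) * X i with hl
  have hle : ∀ x, eval x l = ∑ i, e i * x i := fun x => by simp [hl]
  have hl0 : l ≠ 0 := by
    intro hz
    apply he
    have h2 := hle e
    rw [hz, map_zero] at h2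
    have h3 := (Finset.sum_eq_zero_iff_of_nonneg fun i _ => mul_self_nonneg (e i)).1 h2.symm
    funext i
    exact mul_self_eq_zero.1 (h3 i (Finset.mem_univ i))
  have hz : l * homogeneousComponent m p = 0 := by
    refine eq_zero_of_gaussianMean_eq_zero (fun x => ?_) ?_
    · rw [map_mul, hle]
      obtain ⟨ε, hε, hx⟩ := h x
      -- With `x` fixed, `l x` is a constant, so the lowest-part lemma applies to the scalar
      -- multiple `l x * p` along the ray through `x`.
      have h2 : ∀ k < m, homogeneousComponent k (C (∑ i, e i * x i) * p) = 0 := fun k hkm => by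
        rw [homogeneousComponent_C_mul, hk k hkm, mul_zero]
      have h3 := eval_homogeneousComponent_nonneg h2 (x := x) hε fun t ht => by
        rw [map_mul, eval_C]; exact hx t ht
      rwa [homogeneousComponent_C_mul, map_mul, eval_C] at h3
    · rw [hl, Finset.sum_mul, map_sum]
      refine Finset.sum_eq_zero fun i _ => ?_
      rw [mul_assoc, ← smul_eq_C_mul, map_smul, gaussianMean_X_mul_eq_zero
        (homogeneousComponent_isHomogeneous m p) hm2 (polyLaplacian_homogeneousComponent hL m),
        smul_zero]
  exact (mul_eq_zero.1 hz).elim hl0 hm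

/-! ### Sign rigidity on half balls -/

theorem continuous_polyFun {n : ℕ} (p : MvPolynomial (Fin n) ℝ) : Continuous (polyFun p) :=
  p.continuous_eval.comp (by fun_prop)

theorem eventually_norm_smul_lt_one {n : ℕ} (x : EuclideanSpace ℝ (Fin n)) :
    ∃ ε : ℝ, 0 < ε ∧ ∀ t ∈ Ioo 0 ε, ‖t • x‖ < 1 := by
  refine ⟨1 / (‖x‖ + 1), by positivity, fun t ht => ?_⟩
  rw [norm_smul, Real.norm_of_nonneg ht.1.le]
  have h1 := (lt_div_iff₀ (by positivity)).1 ht.2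
  nlinarith [ht.1, norm_nonneg x]

/-- A harmonic polynomial vanishing at the origin and nonnegative on the unit ball is zero. -/
theorem harmonic_eq_zero_of_nonneg_on_ball {n : ℕ} {p : MvPolynomial (Fin n) ℝ}
    (hL : polyLaplacian n p = 0) (h0 : eval 0 p = 0)
    (h : ∀ x : EuclideanSpace ℝ (Fin n), ‖x‖ < 1 → 0 ≤ polyFun p x) : p = 0 := by
  refine harmonic_eq_zero_of_nonneg hL h0 fun x => ?_
  obtain ⟨ε, hε, hx⟩ := eventually_norm_smul_lt_one (WithLp.toLp 2 x)
  refine ⟨ε, hε, fun t ht => ?_⟩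
  have h2 := h _ (hx t ht)
  exact h2

theorem harmonic_eq_zero_of_inner_mul_nonneg_on_ball {n : ℕ} {p : MvPolynomial (Fin n) ℝ}
    (hL : polyLaplacian n p = 0) (h0 : eval 0 p = 0) (h1 : ∀ i, eval 0 (pderiv i p) = 0)
    {e : EuclideanSpace ℝ (Fin n)} (he : e ≠ 0)
    (h : ∀ x : EuclideanSpace ℝ (Fin n), ‖x‖ < 1 → 0 ≤ inner ℝ x e * polyFun p x) : p = 0 := by
  refine harmonic_eq_zero_of_linear_mul_nonneg hL h0 h1 (e := fun i => e i)
    (fun hz => he (by ext i; exact congrFun hz i)) fun x => ?_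
  obtain ⟨ε, hε, hx⟩ := eventually_norm_smul_lt_one (WithLp.toLp 2 x)
  refine ⟨ε, hε, fun t ht => ?_⟩
  have h2 := h _ (hx t ht)
  rw [real_inner_smul_left, mul_assoc] at h2
  have h3 := nonneg_of_mul_nonneg_right h2 ht.1
  have h4 : inner ℝ (WithLp.toLp 2 x) e = ∑ i, e i * x i := by
    simp [PiLp.inner_apply]
  rw [h4] at h3
  exact h3

/-- The gradient at the origin of a polynomial. -/
noncomputable def gradAtZero (n : ℕ) : MvPolynomial (Fin n) ℝ →ₗ[ℝ] EuclideanSpace ℝ (Fin n) where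
  toFun p := WithLp.toLp 2 fun i => eval 0 (pderiv i p)
  map_add' p q := by ext i; simp
  map_smul' a p := by ext i; simp

theorem gradAtZero_apply {n : ℕ} (p : MvPolynomial (Fin n) ℝ) (i : Fin n) :
    gradAtZero n p i = eval 0 (pderiv i p) := rfl

/-- Points of the equator are limits, along `e`, of points of the open half ball. -/
theorem nonneg_of_nonneg_on_halfBall {n : ℕ} {f : EuclideanSpace ℝ (Fin n) → ℝ}
    (hf : Continuous f) {e : EuclideanSpace ℝ (Fin n)} (he : ‖e‖ = 1)
    (h : ∀ v, ‖v‖ ≤ 1 → 0 < inner ℝ v e → 0 ≤ f v) {x : EuclideanSpace ℝ (Fin n)}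
    (hx : ‖x‖ < 1) (hxe : inner ℝ x e = 0) : 0 ≤ f x := by
  have hlim : Filter.Tendsto (fun s : ℝ => f (x + s • e)) (𝓝[>] 0) (𝓝 (f x)) := by
    have hc : Continuous fun s : ℝ => f (x + s • e) := by fun_prop
    have := hc.continuousAt.continuousWithinAt (s := Ioi 0) (x := 0)
    simpa [ContinuousWithinAt] using this
  refine ge_of_tendsto hlim ?_
  filter_upwards [Ioo_mem_nhdsGT (show (0 : ℝ) < 1 - ‖x‖ by linarith)] with s hs
  refine h _ ?_ ?_
  · refine (norm_add_le _ _).trans ?_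
    rw [norm_smul, he, Real.norm_of_nonneg hs.1.le]
    linarith [hs.2]
  · rw [inner_add_left, hxe, real_inner_smul_left, real_inner_self_eq_norm_sq, he]
    linarith [hs.1]

/-- If a nonzero harmonic polynomial vanishes at the origin and has constant (weak) sign on each
half ball cut out by the hyperplane `eᗮ`, then its gradient at the origin is nonzero. -/
theorem gradAtZero_ne_zero_of_sign {n : ℕ} {p : MvPolynomial (Fin n) ℝ} (hp : p ≠ 0)
    (hL : polyLaplacian n p = 0) (h0 : eval 0 p = 0)
    {e : EuclideanSpace ℝ (Fin n)} (he : ‖e‖ = 1)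
    (h : ∀ σ : ℝ, σ ≠ 0 → ∀ u v : EuclideanSpace ℝ (Fin n), ‖u‖ ≤ 1 → ‖v‖ ≤ 1 →
      0 < σ * inner ℝ u e → 0 < σ * inner ℝ v e → 0 < polyFun p u → ¬ polyFun p v < 0) :
    gradAtZero n p ≠ 0 := by
  intro hG
  have hG' : ∀ i, eval 0 (pderiv i p) = 0 := fun i => by rw [← gradAtZero_apply, hG]; rfl
  have he0 : e ≠ 0 := fun hz => by simp [hz] at he
  have hsign : ∀ σ : ℝ, σ ≠ 0 →
      (∀ v : EuclideanSpace ℝ (Fin n), ‖v‖ ≤ 1 → 0 < σ * inner ℝ v e → 0 ≤ polyFun p v) ∨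
      (∀ v : EuclideanSpace ℝ (Fin n), ‖v‖ ≤ 1 → 0 < σ * inner ℝ v e → polyFun p v ≤ 0) := by
    intro σ hσ
    by_cases hu : ∃ u : EuclideanSpace ℝ (Fin n), ‖u‖ ≤ 1 ∧ 0 < σ * inner ℝ u e ∧ 0 < polyFun p u
    · obtain ⟨u, hu1, hu2, hu3⟩ := hu
      exact Or.inl fun v hv1 hv2 => not_lt.1 (h σ hσ u v hu1 hv1 hu2 hv2 hu3)
    · push Not at hu
      exact Or.inr hu
  have hneg : ∀ x, polyFun (-p) x = - polyFun p x := fun x => map_neg _ _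
  -- Equal signs make `p` or `-p` nonnegative on the ball; opposite signs make `⟨x, e⟩ p` or `⟨x,
  -- -e⟩ p` nonnegative. Only the latter cases use the vanishing gradient.
  rcases hsign 1 one_ne_zero with h1 | h1 <;> rcases hsign (-1) (by norm_num) with h2 | h2
  · refine hp (harmonic_eq_zero_of_nonneg_on_ball hL h0 fun x hx => ?_)
    rcases lt_trichotomy (inner ℝ x e) 0 with h3 | h3 | h3
    · exact h2 x hx.le (by linarith)
    · exact nonneg_of_nonneg_on_halfBall (continuous_polyFun p) he
        (fun v hv hve => h1 v hv (by linarith)) hx h3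
    · exact h1 x hx.le (by linarith)
  · refine hp (harmonic_eq_zero_of_inner_mul_nonneg_on_ball hL h0 hG' he0 fun x hx => ?_)
    rcases lt_trichotomy (inner ℝ x e) 0 with h3 | h3 | h3
    · exact mul_nonneg_of_nonpos_of_nonpos h3.le (h2 x hx.le (by linarith))
    · rw [h3, zero_mul]
    · exact mul_nonneg h3.le (h1 x hx.le (by linarith))
  · refine hp (harmonic_eq_zero_of_inner_mul_nonneg_on_ball hL h0 hG' (neg_ne_zero.2 he0)
      fun x hx => ?_)
    rw [inner_neg_right]
    rcases lt_trichotomy (inner ℝ x e) 0 with h3 | h3 | h3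
    · exact mul_nonneg (by linarith) (h2 x hx.le (by linarith))
    · rw [h3, neg_zero, zero_mul]
    · exact mul_nonneg_of_nonpos_of_nonpos (by linarith) (h1 x hx.le (by linarith))
  · refine hp (neg_eq_zero.1 (harmonic_eq_zero_of_nonneg_on_ball (p := -p) (by simp [hL])
      (by rw [map_neg, h0, neg_zero]) fun x hx => ?_))
    rcases lt_trichotomy (inner ℝ x e) 0 with h3 | h3 | h3
    · rw [hneg]; linarith [h2 x hx.le (by linarith)]
    · exact nonneg_of_nonneg_on_halfBall (continuous_polyFun (-p)) he
        (fun v hv hve => by rw [hneg]; linarith [h1 v hv (by linarith)]) hx h3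
    · rw [hneg]; linarith [h1 x hx.le (by linarith)]

/-! ### The gap by compactness -/

/-- A continuous function with a positive and a negative value on a convex set has a zero there. -/
theorem exists_zero_of_convex {E : Type*} [AddCommGroup E] [Module ℝ E] [TopologicalSpace E]
    [ContinuousAdd E] [ContinuousSMul ℝ E] {f : E → ℝ} (hf : Continuous f) {s : Set E}
    (hs : Convex ℝ s) {u v : E} (hu : u ∈ s) (hv : v ∈ s) (hfu : 0 < f u) (hfv : f v < 0) :
    ∃ z ∈ s, f z = 0 := by
  obtain ⟨z, hz, hz0⟩ := hs.isPreconnected.intermediate_value hv hu hf.continuousOn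
    (show (0 : ℝ) ∈ Icc (f v) (f u) from ⟨hfv.le, hfu.le⟩)
  exact ⟨z, hz, hz0⟩

/-- In a finite-dimensional family of polynomials, harmonic polynomials whose zeros in the unit
ball are close to a hyperplane have a gradient at the origin bounded from below. -/
theorem exists_flatness_gap {n : ℕ} {E : Type*} [NormedAddCommGroup E] [NormedSpace ℝ E]
    [FiniteDimensional ℝ E] (P : E →ₗ[ℝ] MvPolynomial (Fin n) ℝ) (hP : Function.Injective P) :
    ∃ δ : ℝ, 0 < δ ∧ ∀ c : E, ‖c‖ = 1 → polyLaplacian n (P c) = 0 → eval 0 (P c) = 0 →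
      ∀ e : EuclideanSpace ℝ (Fin n), ‖e‖ = 1 →
      (∀ z, ‖z‖ ≤ 1 → polyFun (P c) z = 0 → |inner ℝ z e| < δ) →
      δ ≤ ‖gradAtZero n (P c)‖ := by
  by_contra! hcon
  have hex : ∀ k : ℕ, ∃ ce : E × EuclideanSpace ℝ (Fin n),
      (ce ∈ sphere (0 : E) 1 ×ˢ sphere (0 : EuclideanSpace ℝ (Fin n)) 1) ∧
      polyLaplacian n (P ce.1) = 0 ∧ eval 0 (P ce.1) = 0 ∧
      (∀ z, ‖z‖ ≤ 1 → polyFun (P ce.1) z = 0 → |inner ℝ z ce.2| < 1 / ((k : ℝ) + 1)) ∧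
      ‖gradAtZero n (P ce.1)‖ < 1 / ((k : ℝ) + 1) := by
    intro k
    obtain ⟨c, hc, hL, h0, e, he, hz, hG⟩ := hcon (1 / ((k : ℝ) + 1)) (by positivity)
    exact ⟨(c, e), ⟨by simpa using hc, by simpa using he⟩, hL, h0, hz, hG⟩
  choose ce hce hL h0 hz hG using hex
  obtain ⟨⟨c, e⟩, hmem, φ, hφ, hlim⟩ :=
    ((isCompact_sphere (0 : E) 1).prod
      (isCompact_sphere (0 : EuclideanSpace ℝ (Fin n)) 1)).tendsto_subseq hce
  have hc1 : ‖c‖ = 1 := by simpa using hmem.1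
  have he1 : ‖e‖ = 1 := by simpa using hmem.2
  have hclim : Filter.Tendsto (fun k => (ce (φ k)).1) Filter.atTop (𝓝 c) :=
    (continuous_fst.tendsto _).comp hlim
  have helim : Filter.Tendsto (fun k => (ce (φ k)).2) Filter.atTop (𝓝 e) :=
    (continuous_snd.tendsto _).comp hlim
  have hδ : Filter.Tendsto (fun k : ℕ => 1 / (((φ k : ℕ) : ℝ) + 1)) Filter.atTop (𝓝 0) :=
    tendsto_one_div_add_atTop_nhds_zero_nat.comp hφ.tendsto_atTop
  -- Linear maps out of the finite-dimensional `E` are continuous, so harmonicity, the zero at the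
  -- origin and point values all pass to the limit.
  have hev : ∀ (x : Fin n → ℝ) (T : MvPolynomial (Fin n) ℝ →ₗ[ℝ] MvPolynomial (Fin n) ℝ),
      Filter.Tendsto (fun k => eval x (T (P (ce (φ k)).1))) Filter.atTop
        (𝓝 (eval x (T (P c)))) := by
    intro x T
    have hc : Continuous ((aeval (R := ℝ) x).toLinearMap ∘ₗ T ∘ₗ P) :=
      LinearMap.continuous_of_finiteDimensional _
    exact (hc.tendsto c).comp hclim
  have hLc : polyLaplacian n (P c) = 0 := by
    refine MvPolynomial.funext fun x => tendsto_nhds_unique (hev x (polyLaplacian n)) ?_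
    simp [hL]
  have h0c : eval 0 (P c) = 0 := by
    refine tendsto_nhds_unique (hev 0 LinearMap.id) ?_
    simp only [LinearMap.id_apply, h0, tendsto_const_nhds]
  have hGc : gradAtZero n (P c) = 0 := by
    have hc : Continuous (gradAtZero n ∘ₗ P) := LinearMap.continuous_of_finiteDimensional _
    have h1 := ((hc.tendsto c).comp hclim).norm
    have h2 := le_of_tendsto_of_tendsto' h1 hδ fun k => (hG (φ k)).le
    exact norm_le_zero_iff.1 h2
  have hPc : P c ≠ 0 := fun hzero => by
    have : c = 0 := hP (by rw [hzero, map_zero])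
    simp [this] at hc1
  refine gradAtZero_ne_zero_of_sign hPc hLc h0c he1 ?_ hGc
  intro σ hσ u v hu hv hue hve hpu hpv
  -- The part of the ball with `η ≤ σ ⟨z, e⟩` is convex and contains `u` and `v`. For large `k` the
  -- approximant changes sign there, so it has a zero there, whereas its zeros approach the
  -- hyperplane `eᗮ`.
  set η : ℝ := min (σ * inner ℝ u e) (σ * inner ℝ v e) with hη
  have hη0 : 0 < η := lt_min hue hve
  have hu' := (hev (fun i => u i) LinearMap.id).eventually_const_lt hpu
  have hv' := (hev (fun i => v i) LinearMap.id).eventually_lt_const hpv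
  have hsmall : Filter.Tendsto
      (fun k => |σ| * (1 / (((φ k : ℕ) : ℝ) + 1) + ‖(ce (φ k)).2 - e‖)) Filter.atTop (𝓝 0) := by
    have h1 : Filter.Tendsto (fun k => ‖(ce (φ k)).2 - e‖) Filter.atTop (𝓝 0) := by
      simpa using (helim.sub_const e).norm
    simpa using (hδ.add h1).const_mul |σ|
  obtain ⟨k, hku, hkv, hk⟩ := (hu'.and (hv'.and (hsmall.eventually_lt_const hη0))).exists
  have hconv : Convex ℝ (closedBall (0 : EuclideanSpace ℝ (Fin n)) 1 ∩
      {z | η ≤ σ * inner ℝ z e}) := by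
    refine (convex_closedBall _ _).inter ?_
    refine convex_halfSpace_ge (f := fun z => σ * inner ℝ z e) ⟨fun x y => ?_, fun a x => ?_⟩ η
    · rw [inner_add_left, mul_add]
    · rw [real_inner_smul_left, smul_eq_mul]; ring
  obtain ⟨z, ⟨hz1, hz2⟩, hz0⟩ := exists_zero_of_convex (continuous_polyFun (P (ce (φ k)).1)) hconv
    (u := u) (v := v) ⟨by simpa using hu, min_le_left (σ * inner ℝ u e) (σ * inner ℝ v e)⟩
    ⟨by simpa using hv, min_le_right (σ * inner ℝ u e) (σ * inner ℝ v e)⟩ hku hkv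
  have hz1' : ‖z‖ ≤ 1 := by simpa using hz1
  have h1 := hz (φ k) z hz1' hz0
  have h2 : |inner ℝ z ((ce (φ k)).2 - e)| ≤ ‖(ce (φ k)).2 - e‖ :=
    (abs_real_inner_le_norm _ _).trans (mul_le_of_le_one_left (norm_nonneg _) hz1')
  rw [inner_sub_right] at h2
  have h3 : |inner ℝ z e| ≤ 1 / (((φ k : ℕ) : ℝ) + 1) + ‖(ce (φ k)).2 - e‖ := by
    have := abs_sub_abs_le_abs_sub (inner ℝ z e) (inner ℝ z (ce (φ k)).2)
    rw [abs_sub_comm] at this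
    linarith
  have h4 : σ * inner ℝ z e ≤ |σ| * |inner ℝ z e| := by
    rw [← abs_mul]; exact le_abs_self _
  have h5 := mul_le_mul_of_nonneg_left h3 (abs_nonneg σ)
  have h6 : η ≤ σ * inner ℝ z e := hz2
  linarith

/-! ### Local flatness versus slabs and linear approximation -/

theorem finrank_orthogonal_singleton_add_one {n : ℕ} {e : EuclideanSpace ℝ (Fin n)} (he : e ≠ 0) :
    Module.finrank ℝ (Submodule.span ℝ {e})ᗮ + 1 = n := by
  have h := (Submodule.span ℝ {e}).finrank_add_finrank_orthogonal
  rw [finrank_span_singleton he, finrank_euclideanSpace_fin] at h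
  omega

/-- A function that is close to a linear function to second order has a flat zero set. -/
theorem localFlatness_zeroSet_le {n : ℕ} {f : EuclideanSpace ℝ (Fin n) → ℝ} (hf : Continuous f)
    {x e : EuclideanSpace ℝ (Fin n)} {r a T s : ℝ} (hr : 0 < r) (ha : 0 < a) (hT : 0 ≤ T)
    (he : ‖e‖ = 1)
    (h : ∀ y, ‖y‖ ≤ 1 → |f (x + r • y) - a * inner ℝ y e| ≤ T * a * ‖y‖ ^ 2)
    (hs : s ∈ Ioo (0 : ℝ) 1) :
    localFlatness (zeroSet f) x (s * r) ≤ ((T + 1) ^ 2 + (T + 1)) * s := by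
  obtain ⟨hs0, hs1⟩ := hs
  have he0 : e ≠ 0 := fun hz => by simp [hz] at he
  have hee : inner ℝ e e = (1 : ℝ) := by rw [real_inner_self_eq_norm_sq, he, one_pow]
  have hfx : f x = 0 := by
    have := h 0 (by simp)
    simpa using this
  rw [localFlatness, one_div, inv_mul_le_iff₀ (by positivity)]
  refine (ciInf_le ⟨0, ?_⟩ ⟨(Submodule.span ℝ {e})ᗮ,
    finrank_orthogonal_singleton_add_one he0⟩).trans ?_
  · rintro _ ⟨L, rfl⟩
    exact hausdorffDist_nonneg
  refine hausdorffDist_le_of_mem_dist (by positivity) ?_ ?_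
  · rintro z ⟨hz0, hz⟩
    obtain ⟨y, rfl⟩ : ∃ y, z = x + r • y :=
      ⟨r⁻¹ • (z - x), by rw [smul_inv_smul₀ hr.ne', add_sub_cancel]⟩
    have hy : ‖y‖ ≤ s := by
      rw [mem_closedBall, dist_self_add_left, norm_smul, Real.norm_of_nonneg hr.le, mul_comm] at hz
      exact le_of_mul_le_mul_right hz hr
    -- At a zero the linear term equals the error, so the orthogonal projection to `eᗮ` moves the
    -- point by at most `r * T * s ^ 2`.
    have hye : |inner ℝ y e| ≤ T * s ^ 2 := by
      have h1 := h y (hy.trans hs1.le)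
      have hz0' : f (x + r • y) = 0 := hz0
      rw [hz0', zero_sub, abs_neg, abs_mul, abs_of_pos ha] at h1
      have h2 : ‖y‖ ^ 2 ≤ s ^ 2 := by gcongr
      have h3 : a * |inner ℝ y e| ≤ a * (T * s ^ 2) := by
        nlinarith [mul_le_mul_of_nonneg_left h2 (mul_nonneg hT ha.le)]
      exact le_of_mul_le_mul_left h3 ha
    refine ⟨x + r • (y - (inner ℝ y e : ℝ) • e), ⟨⟨_, ?_, rfl⟩, ?_⟩, ?_⟩
    · refine Submodule.smul_mem _ _ ?_
      rw [Submodule.mem_orthogonal_singleton_iff_inner_left, inner_sub_left, real_inner_smul_left,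
        hee, mul_one, sub_self]
    · rw [mem_closedBall, dist_self_add_left, norm_smul, Real.norm_of_nonneg hr.le, mul_comm]
      refine mul_le_mul_of_nonneg_right (le_trans ?_ hy) hr.le
      refine abs_le_of_sq_le_sq' ?_ (norm_nonneg y) |>.2
      rw [norm_sub_sq_real, real_inner_smul_right, norm_smul, he, Real.norm_eq_abs, mul_one, sq_abs]
      nlinarith [sq_nonneg (inner ℝ y e : ℝ)]
    · rw [dist_add_left, dist_eq_norm, ← smul_sub, sub_sub_cancel, norm_smul, norm_smul, he,
        mul_one, Real.norm_of_nonneg hr.le, Real.norm_eq_abs]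
      have h1 := mul_le_mul_of_nonneg_left hye hr.le
      have h2 : 0 ≤ s ^ 2 * r := by positivity
      nlinarith [mul_nonneg h2 (sq_nonneg (T + 1))]
  · rintro _ ⟨⟨v, hv, rfl⟩, hz⟩
    obtain ⟨y, rfl⟩ : ∃ y, v = r • y := ⟨r⁻¹ • v, by rw [smul_inv_smul₀ hr.ne']⟩
    have hy : ‖y‖ ≤ s := by
      rw [mem_closedBall, dist_self_add_left, norm_smul, Real.norm_of_nonneg hr.le, mul_comm] at hz
      exact le_of_mul_le_mul_right hz hr
    have hye : inner ℝ y e = (0 : ℝ) := by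
      have h1 := Submodule.mem_orthogonal_singleton_iff_inner_left.1 hv
      rw [real_inner_smul_left] at h1
      exact (mul_eq_zero.1 h1).resolve_left hr.ne'
    -- A zero is sought near the hyperplane point `y` by moving along `e`. Shrinking `y` by the
    -- factor `1 - u` first makes room to move by up to `τ = (T + 1) s²` without leaving the ball,
    -- and `a τ` exceeds the error `T a s²`, which forces a sign change.
    set u : ℝ := (T + 1) ^ 2 * s with hu
    have hu0 : 0 < u := by positivity
    -- If `1 < u`, the claimed bound exceeds the radius `s * r`, and the centre `x` is itself a
    -- close enough zero.
    rcases lt_or_ge 1 u with hu1 | hu1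
    · refine ⟨x, ⟨hfx, mem_closedBall_self (by positivity)⟩, ?_⟩
      change dist (x + r • y) x ≤ _
      rw [dist_self_add_left, norm_smul, Real.norm_of_nonneg hr.le]
      have h1 : r * ‖y‖ ≤ r * s := by gcongr
      have h2 : 0 < r * s := by positivity
      have h3 : (T + 1) * s ≥ 0 := by positivity
      nlinarith [mul_pos h2 (sub_pos.2 hu1), mul_nonneg h2.le h3]
    · set τ : ℝ := (T + 1) * s ^ 2 with hτ
      have hτ0 : 0 < τ := by positivity
      have hτs : τ ^ 2 = u * s * s ^ 2 := by rw [hτ, hu]; ring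
      have hnorm : ∀ t ∈ Icc (-τ) τ, ‖(1 - u) • y + t • e‖ ≤ s := by
        intro t ht
        refine abs_le_of_sq_le_sq' ?_ hs0.le |>.2
        rw [norm_add_sq_real, real_inner_smul_left, real_inner_smul_right, hye, norm_smul,
          norm_smul, he, Real.norm_of_nonneg (by linarith), Real.norm_eq_abs, mul_one, sq_abs]
        have h1 : t ^ 2 ≤ τ ^ 2 := sq_le_sq' ht.1 ht.2
        have h2 : ‖y‖ ^ 2 ≤ s ^ 2 := by gcongr
        have h3 : (1 - u) ^ 2 * ‖y‖ ^ 2 ≤ (1 - u) ^ 2 * s ^ 2 :=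
          mul_le_mul_of_nonneg_left h2 (sq_nonneg _)
        -- This is where `u` is calibrated: `τ ^ 2 = u * s * s ^ 2`, and `u ≤ 1`, `s < 1` give `u +
        -- s ≤ 2`.
        have h4 : (1 - u) ^ 2 + u * s ≤ 1 := by nlinarith
        have h5 := mul_le_mul_of_nonneg_right h4 (sq_nonneg s)
        nlinarith
      set g : ℝ → ℝ := fun t => f (x + r • ((1 - u) • y + t • e)) with hg
      have hgc : Continuous g := by fun_prop
      have hge : ∀ t ∈ Icc (-τ) τ, |g t - a * t| ≤ T * a * s ^ 2 := by
        intro t ht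
        have h1 := h _ ((hnorm t ht).trans hs1.le)
        rw [inner_add_left, real_inner_smul_left, real_inner_smul_left, hye, hee, mul_zero,
          zero_add, mul_one] at h1
        have h2 : ‖(1 - u) • y + t • e‖ ^ 2 ≤ s ^ 2 := by
          have := hnorm t ht
          gcongr
        exact h1.trans (mul_le_mul_of_nonneg_left h2 (by positivity))
      have has : 0 < a * s ^ 2 := by positivity
      have h1 := abs_le.1 (hge τ ⟨by linarith, le_rfl⟩)
      have h2 := abs_le.1 (hge (-τ) ⟨le_rfl, by linarith⟩)
      have h3 : 0 ≤ g τ := by nlinarith [h1.1]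
      have h4 : g (-τ) ≤ 0 := by nlinarith [h2.2]
      obtain ⟨t, ht, ht0⟩ := intermediate_value_Icc (show -τ ≤ τ by linarith)
        hgc.continuousOn (show (0 : ℝ) ∈ Icc (g (-τ)) (g τ) from ⟨h4, h3⟩)
      refine ⟨x + r • ((1 - u) • y + t • e), ⟨ht0, ?_⟩, ?_⟩
      · rw [mem_closedBall, dist_self_add_left, norm_smul, Real.norm_of_nonneg hr.le, mul_comm]
        exact mul_le_mul_of_nonneg_right (hnorm t ht) hr.le
      · change dist (x + r • y) _ ≤ _
        rw [dist_add_left, dist_eq_norm, ← smul_sub, norm_smul, Real.norm_of_nonneg hr.le]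
        have h5 : y - ((1 - u) • y + t • e) = u • y - t • e := by
          rw [sub_smul, one_smul]; abel
        have h6 : ‖u • y - t • e‖ ≤ u * s + τ := by
          refine (norm_sub_le _ _).trans (add_le_add ?_ ?_)
          · rw [norm_smul, Real.norm_of_nonneg hu0.le]
            exact mul_le_mul_of_nonneg_left hy hu0.le
          · rw [norm_smul, he, mul_one]
            exact abs_le.2 ht
        rw [h5]
        refine (mul_le_mul_of_nonneg_left h6 hr.le).trans (le_of_eq ?_)
        rw [hu, hτ]; ring

/-- Converts flatness into the slab hypothesis of `exists_flatness_gap`: `e` is a unit normal of a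
hyperplane whose Hausdorff distance is below `δ * r`. -/
theorem exists_inner_lt_of_localFlatness_lt {n : ℕ} (hn : 1 ≤ n) {f : EuclideanSpace ℝ (Fin n) → ℝ}
    {x : EuclideanSpace ℝ (Fin n)} {r δ : ℝ} (hr : 0 < r) (hfx : f x = 0)
    (h : localFlatness (zeroSet f) x r < δ) :
    ∃ e : EuclideanSpace ℝ (Fin n), ‖e‖ = 1 ∧
      ∀ z, ‖z‖ ≤ 1 → f (x + r • z) = 0 → |inner ℝ z e| < δ := by
  have hne : Nonempty {L : Submodule ℝ (EuclideanSpace ℝ (Fin n)) //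
      Module.finrank ℝ L + 1 = n} :=
    ⟨⟨_, finrank_orthogonal_singleton_add_one
      (e := EuclideanSpace.single ⟨0, hn⟩ (1 : ℝ)) fun hz => by simp at hz⟩⟩
  rw [localFlatness, one_div, inv_mul_lt_iff₀ hr] at h
  obtain ⟨⟨L, hL⟩, hlt⟩ := exists_lt_of_ciInf_lt h
  have hL1 : 0 < Module.finrank ℝ Lᗮ := by
    have h1 := L.finrank_add_finrank_orthogonal
    rw [finrank_euclideanSpace_fin] at h1
    omega
  obtain ⟨⟨w, hw⟩, hw0⟩ := Module.finrank_pos_iff_exists_ne_zero.1 hL1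
  have hw0' : w ≠ 0 := fun hz => hw0 (by simpa using hz)
  have hwn : 0 < ‖w‖ := norm_pos_iff.2 hw0'
  have he : ‖‖w‖⁻¹ • w‖ = 1 := by
    rw [norm_smul, norm_inv, norm_norm, inv_mul_cancel₀ hwn.ne']
  refine ⟨‖w‖⁻¹ • w, he, fun z hz hz0 => ?_⟩
  have hx1 : x ∈ zeroSet f ∩ closedBall x r := ⟨hfx, mem_closedBall_self hr.le⟩
  have hx2 : x ∈ ((fun v => x + v) '' (L : Set (EuclideanSpace ℝ (Fin n)))) ∩ closedBall x r :=
    ⟨⟨0, L.zero_mem, add_zero x⟩, mem_closedBall_self hr.le⟩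
  have hzmem : x + r • z ∈ zeroSet f ∩ closedBall x r := by
    refine ⟨hz0, ?_⟩
    rw [mem_closedBall, dist_self_add_left, norm_smul, Real.norm_of_nonneg hr.le]
    exact mul_le_of_le_one_right hr.le hz
  obtain ⟨_, ⟨⟨v, hv, rfl⟩, -⟩, hd⟩ := exists_dist_lt_of_hausdorffDist_lt hzmem hlt
    -- Finiteness matters: `hausdorffDist` takes the value 0 when the extended distance is infinite.
    (hausdorffEDist_ne_top_of_nonempty_of_bounded ⟨x, hx1⟩ ⟨x, hx2⟩
      (isBounded_closedBall.subset inter_subset_right)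
      (isBounded_closedBall.subset inter_subset_right))
  change dist (x + r • z) (x + v) < _ at hd
  rw [dist_add_left, dist_eq_norm] at hd
  have hve : inner ℝ v (‖w‖⁻¹ • w) = (0 : ℝ) := by
    rw [real_inner_smul_right, L.mem_orthogonal w |>.1 hw v hv, mul_zero]
  have h1 := abs_real_inner_le_norm (r • z - v) (‖w‖⁻¹ • w)
  rw [inner_sub_left, hve, sub_zero, real_inner_smul_left, he, mul_one, abs_mul,
    abs_of_pos hr] at h1
  exact lt_of_mul_lt_mul_left (h1.trans_lt hd) hr.le

/-! ### Rescaling and derivatives of polynomials -/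

/-- The affine substitution `p(x + r y)`, as a polynomial in `y`. -/
noncomputable def affineSubst {n : ℕ} (x : Fin n → ℝ) (r : ℝ) :
    MvPolynomial (Fin n) ℝ →ₐ[ℝ] MvPolynomial (Fin n) ℝ :=
  bind₁ fun i => C (x i) + C r * X i

theorem eval_affineSubst {n : ℕ} (x y : Fin n → ℝ) (r : ℝ) (p : MvPolynomial (Fin n) ℝ) :
    eval y (affineSubst x r p) = eval (x + r • y) p := by
  induction p using MvPolynomial.induction_on with
  | C a => simp [affineSubst]
  | add p q hp hq => simp only [map_add, hp, hq]
  | mul_X p i hp => rw [map_mul, map_mul, hp]; simp [affineSubst]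

theorem pderiv_affineSubst {n : ℕ} (x : Fin n → ℝ) (r : ℝ) (i : Fin n)
    (p : MvPolynomial (Fin n) ℝ) :
    pderiv i (affineSubst x r p) = C r * affineSubst x r (pderiv i p) := by
  induction p using MvPolynomial.induction_on with
  | C a => simp [affineSubst]
  | add p q hp hq => simp only [map_add, hp, hq, mul_add]
  | mul_X p j hp =>
    have hX : affineSubst x r (X j) = C (x j) + C r * X j := bind₁_X_right _ _
    classical
    simp only [map_mul, pderiv_mul, hp, hX, map_add, pderiv_C, pderiv_X, Pi.single_apply]
    split_ifs <;> simp <;> ring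

theorem polyLaplacian_affineSubst {n : ℕ} (x : Fin n → ℝ) (r : ℝ) {p : MvPolynomial (Fin n) ℝ}
    (hp : polyLaplacian n p = 0) : polyLaplacian n (affineSubst x r p) = 0 := by
  simp only [polyLaplacian_apply, pderiv_affineSubst, pderiv_C_mul, ← Finset.mul_sum]
  rw [← map_sum, ← polyLaplacian_apply, hp, map_zero, mul_zero, mul_zero]

/-- Keeps all rescalings in one finite-dimensional space, which the compactness argument needs. -/
theorem totalDegree_affineSubst_le {n : ℕ} (x : Fin n → ℝ) (r : ℝ) (p : MvPolynomial (Fin n) ℝ) :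
    (affineSubst x r p).totalDegree ≤ p.totalDegree := by
  rw [← mem_restrictTotalDegree]
  have h : affineSubst x r p = ∑ u ∈ p.support, affineSubst x r (monomial u (coeff u p)) := by
    rw [← map_sum, ← p.as_sum]
  rw [h]
  refine Submodule.sum_mem _ fun u hu => ?_
  rw [mem_restrictTotalDegree, affineSubst, bind₁_monomial]
  refine (totalDegree_mul _ _).trans ?_
  rw [totalDegree_C, zero_add]
  refine (totalDegree_finsetProd _ _).trans (le_trans ?_ (le_totalDegree hu))
  refine Finset.sum_le_sum fun i _ => (totalDegree_pow _ _).trans ?_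
  refine (Nat.mul_le_mul_left _ ?_).trans (mul_one _).le
  refine (totalDegree_add _ _).trans (max_le (by simp) ((totalDegree_mul _ _).trans ?_))
  simp

theorem hasFDerivAt_polyFun {n : ℕ} (p : MvPolynomial (Fin n) ℝ) (x : EuclideanSpace ℝ (Fin n)) :
    HasFDerivAt (polyFun p)
      (∑ i, polyFun (pderiv i p) x • (EuclideanSpace.proj i : EuclideanSpace ℝ (Fin n) →L[ℝ] ℝ))
      x := by
  induction p using MvPolynomial.induction_on with
  | C a =>
    have h : polyFun (C a : MvPolynomial (Fin n) ℝ) = fun _ => a := by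
      funext y; simp [polyFun]
    rw [h]
    simpa [polyFun] using hasFDerivAt_const (𝕜 := ℝ) a x
  | add p q hp hq =>
    have h : polyFun (p + q) = fun y => polyFun p y + polyFun q y := by
      funext y; simp [polyFun]
    rw [h]
    convert! hp.add hq using 1
    simp [polyFun, add_smul, Finset.sum_add_distrib]
  | mul_X p j hp =>
    have h : polyFun (p * X j) = fun y => polyFun p y * y j := by
      funext y; simp [polyFun]
    rw [h]
    convert! hp.mul
      (EuclideanSpace.proj j : EuclideanSpace ℝ (Fin n) →L[ℝ] ℝ).hasFDerivAt using 1
    classical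
    ext v
    simp [polyFun, pderiv_X, Pi.single_apply, add_mul, Finset.sum_add_distrib,
      Finset.mul_sum, apply_ite (eval fun i => x i), ite_mul, mul_assoc]

theorem fderiv_polyFun_apply_single {n : ℕ} (p : MvPolynomial (Fin n) ℝ)
    (x : EuclideanSpace ℝ (Fin n)) (i : Fin n) :
    fderiv ℝ (polyFun p) x (EuclideanSpace.single i 1) = polyFun (pderiv i p) x := by
  rw [(hasFDerivAt_polyFun p x).fderiv]
  simp

theorem fderiv_polyFun_eq_zero_iff {n : ℕ} (p : MvPolynomial (Fin n) ℝ)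
    (x : EuclideanSpace ℝ (Fin n)) :
    fderiv ℝ (polyFun p) x = 0 ↔ ∀ i, polyFun (pderiv i p) x = 0 := by
  refine ⟨fun h i => ?_, fun h => ?_⟩
  · rw [← fderiv_polyFun_apply_single, h]; rfl
  · rw [(hasFDerivAt_polyFun p x).fderiv]
    simp [h]

theorem differentiable_fderiv_polyFun {n : ℕ} (p : MvPolynomial (Fin n) ℝ) :
    Differentiable ℝ (fderiv ℝ (polyFun p)) := by
  have h : fderiv ℝ (polyFun p) = fun x => ∑ i, polyFun (pderiv i p) x •
      (EuclideanSpace.proj i : EuclideanSpace ℝ (Fin n) →L[ℝ] ℝ) :=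
    funext fun x => (hasFDerivAt_polyFun p x).fderiv
  rw [h]
  have hd : ∀ i, Differentiable ℝ (polyFun (pderiv i p)) := fun i x =>
    (hasFDerivAt_polyFun _ x).differentiableAt
  fun_prop

theorem laplacian_polyFun {n : ℕ} (p : MvPolynomial (Fin n) ℝ) (x : EuclideanSpace ℝ (Fin n)) :
    Laplacian.laplacian (polyFun p) x = polyFun (polyLaplacian n p) x := by
  rw [InnerProductSpace.laplacian_eq_iteratedFDeriv_orthonormalBasis (polyFun p)
    (EuclideanSpace.basisFun (Fin n) ℝ), polyLaplacian_apply]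
  simp only [polyFun, map_sum]
  refine Finset.sum_congr rfl fun i _ => ?_
  rw [iteratedFDeriv_two_apply]
  simp only [EuclideanSpace.basisFun_apply, Matrix.cons_val_zero, Matrix.cons_val_one]
  have h1 : fderiv ℝ (fun y => fderiv ℝ (polyFun p) y (EuclideanSpace.single i 1)) x
      (EuclideanSpace.single i 1) = polyFun (pderiv i (pderiv i p)) x := by
    rw [← fderiv_polyFun_apply_single]
    simp only [fderiv_polyFun_apply_single]
  rw [fderiv_clm_apply (differentiable_fderiv_polyFun p x) (differentiableAt_const _)] at h1
  rw [← polyFun]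
  simpa using h1

theorem polyLaplacian_eq_zero_of_harmonic {n : ℕ} {p : MvPolynomial (Fin n) ℝ}
    (h : InnerProductSpace.HarmonicOnNhd (polyFun p) univ) : polyLaplacian n p = 0 := by
  refine MvPolynomial.funext fun x => ?_
  have h1 := (h (WithLp.toLp 2 x) (mem_univ _)).2.eq_of_nhds
  rw [laplacian_polyFun] at h1
  simpa [polyFun] using h1

/-! ### Uniform Taylor remainders -/

/-- The second order Taylor remainder at the origin, evaluated at `y`. -/
noncomputable def taylorRemainder {n : ℕ} (y : EuclideanSpace ℝ (Fin n)) :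
    MvPolynomial (Fin n) ℝ →ₗ[ℝ] ℝ :=
  (aeval (R := ℝ) fun i => y i).toLinearMap - (aeval (R := ℝ) fun _ => (0 : ℝ)).toLinearMap -
    (innerₗ (EuclideanSpace ℝ (Fin n)) y) ∘ₗ gradAtZero n

theorem taylorRemainder_apply {n : ℕ} (y : EuclideanSpace ℝ (Fin n))
    (p : MvPolynomial (Fin n) ℝ) :
    taylorRemainder y p = polyFun p y - eval 0 p - inner ℝ y (gradAtZero n p) := rfl

theorem exists_taylorRemainder_le {n : ℕ} (p : MvPolynomial (Fin n) ℝ) :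
    ∃ K : ℝ, 0 ≤ K ∧ ∀ y : EuclideanSpace ℝ (Fin n), ‖y‖ ≤ 1 →
      |taylorRemainder y p| ≤ K * ‖y‖ ^ 2 := by
  induction p using MvPolynomial.induction_on with
  | C a =>
    refine ⟨0, le_rfl, fun y _ => ?_⟩
    have h : gradAtZero n (C a) = 0 := by ext i; simp [gradAtZero_apply]
    rw [taylorRemainder_apply, h]
    simp [polyFun]
  | add p q hp hq =>
    obtain ⟨K, hK, h1⟩ := hp
    obtain ⟨K', hK', h2⟩ := hq
    refine ⟨K + K', add_nonneg hK hK', fun y hy => ?_⟩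
    rw [map_add, add_mul]
    exact (abs_add_le _ _).trans (add_le_add (h1 y hy) (h2 y hy))
  | mul_X p j hp =>
    obtain ⟨K, hK, h1⟩ := hp
    refine ⟨K + ‖gradAtZero n p‖, by positivity, fun y hy => ?_⟩
    -- The remainder of `p * X j` is `(p y - p 0) * y j`, a product of two factors of order `‖y‖`.
    have h2 : taylorRemainder y (p * X j) =
        (taylorRemainder y p + inner ℝ y (gradAtZero n p)) * y j := by
      have h : inner ℝ y (gradAtZero n (p * X j)) = eval 0 p * y j := by
        have : gradAtZero n (p * X j) = EuclideanSpace.single j (eval 0 p) := by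
          classical
          ext i
          rw [gradAtZero_apply, pderiv_mul]
          by_cases hij : i = j
          · subst hij; simp
          · simp [pderiv_X_of_ne (Ne.symm hij), hij]
        rw [this, EuclideanSpace.inner_single_right]
        simp
      rw [taylorRemainder_apply, taylorRemainder_apply, h]
      simp [polyFun]
      ring
    have h3 : |y j| ≤ ‖y‖ := by simpa using PiLp.norm_apply_le y j
    have h4 := abs_real_inner_le_norm y (gradAtZero n p)
    have h5 : |taylorRemainder y p + inner ℝ y (gradAtZero n p)| ≤
        (K + ‖gradAtZero n p‖) * ‖y‖ := by
      refine (abs_add_le _ _).trans ?_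
      nlinarith [h1 y hy, mul_le_mul_of_nonneg_left hy (mul_nonneg hK (norm_nonneg y))]
    rw [h2, abs_mul]
    calc _ ≤ (K + ‖gradAtZero n p‖) * ‖y‖ * ‖y‖ := by gcongr
      _ = _ := by ring

/-- The remainder is linear in the polynomial, so the bounds for the images of the basis vectors add
up. -/
theorem exists_taylorRemainder_le_family {n : ℕ} {ι : Type*} [Fintype ι]
    (P : (ι → ℝ) →ₗ[ℝ] MvPolynomial (Fin n) ℝ) :
    ∃ K : ℝ, 0 ≤ K ∧ ∀ c : ι → ℝ, ∀ y : EuclideanSpace ℝ (Fin n), ‖y‖ ≤ 1 →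
      |taylorRemainder y (P c)| ≤ K * ‖c‖ * ‖y‖ ^ 2 := by
  classical
  choose K hK h using fun j : ι => exists_taylorRemainder_le (P (Pi.single j 1))
  refine ⟨∑ j, K j, Finset.sum_nonneg fun j _ => hK j, fun c y hy => ?_⟩
  have hc : P c = ∑ j, c j • P (Pi.single j 1) := by
    conv_lhs => rw [pi_eq_sum_univ' c]
    simp [map_sum]
  rw [hc, map_sum, Finset.sum_mul, Finset.sum_mul]
  refine (Finset.abs_sum_le_sum_abs _ _).trans (Finset.sum_le_sum fun j _ => ?_)
  rw [map_smul, smul_eq_mul, abs_mul]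
  calc |c j| * |taylorRemainder y (P (Pi.single j 1))| ≤ ‖c‖ * (K j * ‖y‖ ^ 2) :=
        mul_le_mul (norm_le_pi_norm c j) (h j y hy) (abs_nonneg _) (norm_nonneg _)
    _ = _ := by ring

/-! ### Coordinates for rescaled harmonic polynomials -/

/-- A linear parametrisation of the polynomials of degree at most `d` by coordinates. -/
noncomputable def boundedDegreePoly (n d : ℕ) :
    (Fin (Module.finrank ℝ (restrictTotalDegree (Fin n) ℝ d)) → ℝ) →ₗ[ℝ] MvPolynomial (Fin n) ℝ :=
  (restrictTotalDegree (Fin n) ℝ d).subtype ∘ₗ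
    (Module.finBasis ℝ (restrictTotalDegree (Fin n) ℝ d)).equivFun.symm.toLinearMap

theorem boundedDegreePoly_injective (n d : ℕ) : Function.Injective (boundedDegreePoly n d) :=
  Subtype.val_injective.comp (LinearEquiv.injective _)

theorem exists_boundedDegreePoly_eq {n d : ℕ} {p : MvPolynomial (Fin n) ℝ}
    (hp : p.totalDegree ≤ d) : ∃ c, boundedDegreePoly n d c = p :=
  ⟨(Module.finBasis ℝ (restrictTotalDegree (Fin n) ℝ d)).equivFun
    ⟨p, (mem_restrictTotalDegree _ _ _).2 hp⟩, by simp [boundedDegreePoly]⟩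

theorem polyFun_boundedDegreePoly_smul {n d : ℕ} (a : ℝ)
    (c : Fin (Module.finrank ℝ (restrictTotalDegree (Fin n) ℝ d)) → ℝ)
    (z : EuclideanSpace ℝ (Fin n)) :
    polyFun (boundedDegreePoly n d (a • c)) z = a * polyFun (boundedDegreePoly n d c) z := by
  simp [polyFun, smul_eval]

/-- Rescaling of a harmonic polynomial around a zero, in coordinates. -/
theorem IsHarmonicPolynomial.exists_rescaling {n d : ℕ} (hd : 1 ≤ d)
    {h : EuclideanSpace ℝ (Fin n) → ℝ} (hh : IsHarmonicPolynomial d h)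
    {x : EuclideanSpace ℝ (Fin n)} (hx : h x = 0) {r : ℝ} (hr : 0 < r) :
    ∃ c, c ≠ 0 ∧ polyLaplacian n (boundedDegreePoly n d c) = 0 ∧
      eval 0 (boundedDegreePoly n d c) = 0 ∧
      (∀ y, polyFun (boundedDegreePoly n d c) y = h (x + r • y)) ∧
      (gradAtZero n (boundedDegreePoly n d c) = 0 ↔ fderiv ℝ h x = 0) := by
  obtain ⟨⟨p, hpd, rfl⟩, hharm⟩ := hh
  obtain ⟨c, hc⟩ := exists_boundedDegreePoly_eq
    ((totalDegree_affineSubst_le (fun i => x i) r p).trans hpd.le)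
  have hy : ∀ y, polyFun (boundedDegreePoly n d c) y = polyFun p (x + r • y) := by
    intro y
    rw [hc, polyFun, eval_affineSubst]
    rfl
  have hg : ∀ i, gradAtZero n (boundedDegreePoly n d c) i = r * polyFun (pderiv i p) x := by
    intro i
    rw [gradAtZero_apply, hc, pderiv_affineSubst, map_mul, eval_C, eval_affineSubst, smul_zero,
      add_zero, polyFun]
  refine ⟨c, ?_, ?_, ?_, hy, ?_⟩
  · rintro rfl
    -- The zero polynomial has `totalDegree` 0, so `1 ≤ d` excludes it.
    have hp0 : p = 0 := by
      refine MvPolynomial.funext fun z => ?_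
      have h1 := hy (r⁻¹ • (WithLp.toLp 2 z - x))
      rw [smul_inv_smul₀ hr.ne', add_sub_cancel] at h1
      simpa [polyFun] using h1.symm
    rw [hp0, totalDegree_zero] at hpd
    omega
  · rw [hc]
    exact polyLaplacian_affineSubst _ _ (polyLaplacian_eq_zero_of_harmonic hharm)
  · rw [hc, eval_affineSubst, smul_zero, add_zero]
    exact hx
  · rw [fderiv_polyFun_eq_zero_iff]
    refine ⟨fun h0 i => ?_, fun h0 => ?_⟩
    · have h1 := hg i
      rw [h0] at h1
      exact (mul_eq_zero.1 h1.symm).resolve_left hr.ne'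
    · ext i
      rw [hg, h0, mul_zero]
      rfl

theorem IsHarmonicPolynomial.continuous {n d : ℕ} {h : EuclideanSpace ℝ (Fin n) → ℝ}
    (hh : IsHarmonicPolynomial d h) : Continuous h := by
  obtain ⟨⟨p, -, rfl⟩, -⟩ := hh
  exact continuous_polyFun p

/-- If the gradient dominates the Taylor remainder after rescaling, then the zero set is
asymptotically flat. -/
theorem localFlatness_le_of_taylorRemainder_le {n : ℕ} {h : EuclideanSpace ℝ (Fin n) → ℝ}
    (hh : Continuous h) {x : EuclideanSpace ℝ (Fin n)} {r T s : ℝ} (hr : 0 < r) (hT : 0 ≤ T)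
    {q : MvPolynomial (Fin n) ℝ} (hq : ∀ y, polyFun q y = h (x + r • y)) (h0 : eval 0 q = 0)
    (hG : gradAtZero n q ≠ 0)
    (hR : ∀ y : EuclideanSpace ℝ (Fin n), ‖y‖ ≤ 1 →
      |taylorRemainder y q| ≤ T * ‖gradAtZero n q‖ * ‖y‖ ^ 2) (hs : s ∈ Ioo (0 : ℝ) 1) :
    localFlatness (zeroSet h) x (s * r) ≤ ((T + 1) ^ 2 + (T + 1)) * s := by
  have ha : 0 < ‖gradAtZero n q‖ := norm_pos_iff.2 hG
  refine localFlatness_zeroSet_le hh (e := ‖gradAtZero n q‖⁻¹ • gradAtZero n q) hr ha hT ?_ ?_ hs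
  · rw [norm_smul, norm_inv, norm_norm, inv_mul_cancel₀ ha.ne']
  · intro y hy
    have h1 := hR y hy
    rw [taylorRemainder_apply, h0, sub_zero, hq] at h1
    rw [real_inner_smul_right, mul_inv_cancel_left₀ ha.ne']
    exact h1

/-! ### Assembly of the theorem -/

theorem theorem1p4 (n d : ℕ) (hn : 2 ≤ n) (hd : 1 ≤ d) :
    ∃ δ : ℝ, 0 < δ ∧
      (∀ h : EuclideanSpace ℝ (Fin n) → ℝ, IsHarmonicPolynomial d h → ∀ x ∈ zeroSet h,
        (fderiv ℝ h x = 0 ↔ ∀ r : ℝ, 0 < r → δ ≤ localFlatness (zeroSet h) x r) ∧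
        (fderiv ℝ h x ≠ 0 ↔ ∃ r : ℝ, 0 < r ∧ localFlatness (zeroSet h) x r < δ)) ∧
      ∃ C : ℝ, 1 < C ∧
        ∀ h : EuclideanSpace ℝ (Fin n) → ℝ, IsHarmonicPolynomial d h → ∀ x ∈ zeroSet h,
          ∀ r : ℝ, 0 < r → localFlatness (zeroSet h) x r < δ →
            ∀ s ∈ Set.Ioo (0 : ℝ) 1, localFlatness (zeroSet h) x (s * r) < C * s := by
  obtain ⟨δ, hδ, hgap⟩ := exists_flatness_gap _ (boundedDegreePoly_injective n d)
  obtain ⟨K, hK, hrem⟩ := exists_taylorRemainder_le_family (boundedDegreePoly n d)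
  -- The gap for unnormalised coefficients: dividing by `‖c‖` does not change the zeros and scales
  -- the gradient.
  have hkey : ∀ (h : EuclideanSpace ℝ (Fin n) → ℝ) (x : EuclideanSpace ℝ (Fin n)) (r : ℝ)
      (c : Fin (Module.finrank ℝ (restrictTotalDegree (Fin n) ℝ d)) → ℝ), c ≠ 0 → 0 < r →
      polyLaplacian n (boundedDegreePoly n d c) = 0 → eval 0 (boundedDegreePoly n d c) = 0 →
      (∀ y, polyFun (boundedDegreePoly n d c) y = h (x + r • y)) → h x = 0 →
      localFlatness (zeroSet h) x r < δ →
      δ * ‖c‖ ≤ ‖gradAtZero n (boundedDegreePoly n d c)‖ := by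
    intro h x r c hc hr hL h0 hy hx hflat
    obtain ⟨e, he, hz⟩ := exists_inner_lt_of_localFlatness_lt (by omega) hr hx hflat
    have hcn : 0 < ‖c‖ := norm_pos_iff.2 hc
    have h1 := hgap (‖c‖⁻¹ • c) (by rw [norm_smul, norm_inv, norm_norm, inv_mul_cancel₀ hcn.ne'])
      (by rw [map_smul, map_smul, hL, smul_zero]) (by rw [map_smul, smul_eval, h0, mul_zero]) e he
      fun z hz1 hz0 => hz z hz1 (by
        rw [polyFun_boundedDegreePoly_smul] at hz0
        rw [← hy]
        exact (mul_eq_zero.1 hz0).resolve_left (inv_ne_zero hcn.ne'))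
    rw [map_smul, map_smul, norm_smul, norm_inv, norm_norm, ← div_eq_inv_mul,
      le_div_iff₀ hcn] at h1
    exact h1
  have hpos : ∀ h : EuclideanSpace ℝ (Fin n) → ℝ, IsHarmonicPolynomial d h → ∀ x ∈ zeroSet h,
      (∃ r : ℝ, 0 < r ∧ localFlatness (zeroSet h) x r < δ) → fderiv ℝ h x ≠ 0 := by
    rintro h hh x hx ⟨r, hr, hflat⟩ hD
    obtain ⟨c, hc, hL, h0, hy, hG⟩ := hh.exists_rescaling hd hx hr
    have h1 := hkey h x r c hc hr hL h0 hy hx hflat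
    rw [hG.2 hD, norm_zero] at h1
    exact absurd h1 (not_le.2 (mul_pos hδ (norm_pos_iff.2 hc)))
  have hflat : ∀ h : EuclideanSpace ℝ (Fin n) → ℝ, IsHarmonicPolynomial d h → ∀ x ∈ zeroSet h,
      fderiv ℝ h x ≠ 0 → ∃ r : ℝ, 0 < r ∧ localFlatness (zeroSet h) x r < δ := by
    intro h hh x hx hD
    obtain ⟨c, hc, hL, h0, hy, hG⟩ := hh.exists_rescaling hd hx one_pos
    have hG0 := mt hG.1 hD
    have hGn := norm_pos_iff.2 hG0
    -- Here `T` may depend on `h` and `x`, since a single good scale suffices; it is chosen so that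
    -- `A * s ≤ δ / 2`.
    set T : ℝ := K * ‖c‖ / ‖gradAtZero n (boundedDegreePoly n d c)‖ with hT
    have hT0 : 0 ≤ T := by positivity
    set A : ℝ := (T + 1) ^ 2 + (T + 1) with hA
    have hA0 : 0 < A := by positivity
    have hs : min (1 / 2) (δ / (2 * A)) ∈ Ioo (0 : ℝ) 1 :=
      ⟨by positivity, (min_le_left _ _).trans_lt (by norm_num)⟩
    refine ⟨min (1 / 2) (δ / (2 * A)) * 1, by rw [mul_one]; exact hs.1, ?_⟩
    refine (localFlatness_le_of_taylorRemainder_le hh.continuous one_pos hT0 hy h0 hG0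
      (fun y hy1 => ?_) hs).trans_lt ?_
    · rw [hT, div_mul_cancel₀ _ hGn.ne']
      exact hrem c y hy1
    · calc A * min (1 / 2) (δ / (2 * A)) ≤ A * (δ / (2 * A)) := by gcongr; exact min_le_right _ _
        _ = δ / 2 := by field_simp
        _ < δ := by linarith
  refine ⟨δ, hδ, fun h hh x hx => ⟨⟨fun hD r hr => ?_, fun hr => ?_⟩,
    -- The gap makes the remainder ratio at most `K / δ`, uniformly in `h`, `x` and `r`; the final
    -- `+ 1` makes the inequality strict.
    hflat h hh x hx, hpos h hh x hx⟩, (K / δ + 1) ^ 2 + (K / δ + 1) + 1, ?_, ?_⟩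
  · exact not_lt.1 fun hlt => hpos h hh x hx ⟨r, hr, hlt⟩ hD
  · by_contra hD
    obtain ⟨r, hr0, hlt⟩ := hflat h hh x hx hD
    exact absurd hlt (not_lt.2 (hr r hr0))
  · have : 0 ≤ K / δ := by positivity
    nlinarith
  · intro h hh x hx r hr hlt s hs
    obtain ⟨c, hc, hL, h0, hy, hG⟩ := hh.exists_rescaling hd hx hr
    have h1 := hkey h x r c hc hr hL h0 hy hx hlt
    have hG0 : gradAtZero n (boundedDegreePoly n d c) ≠ 0 := by
      rw [← norm_pos_iff]
      exact (mul_pos hδ (norm_pos_iff.2 hc)).trans_le h1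
    refine (localFlatness_le_of_taylorRemainder_le hh.continuous hr (T := K / δ) (by positivity)
      hy h0 hG0 (fun y hy1 => (hrem c y hy1).trans ?_) hs).trans_lt ?_
    · refine mul_le_mul_of_nonneg_right ?_ (sq_nonneg _)
      rw [div_mul_eq_mul_div, le_div_iff₀ hδ, mul_assoc, mul_comm ‖c‖]
      exact mul_le_mul_of_nonneg_left h1 hK
    · linarith [hs.1]
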